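/- A composition of $K$ of length $\ell$ is a tuple $(k_1,\dots,k_\ell)$ of positive integers with $k_1+\cdots+k_\ell=K$. It is primitive if none of its rotations by $i$ places, $0<i<\ell$, equals it (equivalently, it is not a proper power of a shorter tuple). A primitive cyclic composition of weight $K$ and length $\ell$ is a class, up to rotation, of primitive compositions of $K$ of length $\ell$; let $M(K,\ell)$ be the number of these classes. For $K\ge 3$ put $$R(K)=2^{-K}\sum_{\ell>K/\log_2 3} M(K,\ell)\Bigl(\log_2 3-\frac{K}{\ell}\Bigr),$$ a finite sum since $M(K,\ell)=0$ for $\ell>K$, and let $R=\sum_{K\ge 3}R(K)$ and $\varepsilon=2-\log_2 3$. Theorem (per-orbit phantom gain rate). The series $R=\sum_{K\ge3}R(K)$ converges absolutely, and $$R\le 0.0893<\varepsilon,$$ where $\varepsilon\approx 0.415$ (precisely, $|\varepsilon-0.415|<0.0005$). Moreover $\varepsilon/R\ge 4.65$. -/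

import Mathlib

/-- A word `w` is primitive (aperiodic) if no rotation of `w` by `i` places with
`0 < i < w.length` gives back `w`; equivalently, `w` is not a proper power of a shorter word. -/
def IsPrimitiveWord (w : List ℕ) : Prop :=
  ∀ i : ℕ, 0 < i → i < w.length → w.rotate i ≠ w

/-- The primitive cyclic compositions of weight `K` and length `ℓ`: the classes up to rotation
(`Cycle` is Mathlib's quotient of lists by rotation) of the compositions
`K = k₁ + ⋯ + k_ℓ` into `ℓ` positive parts whose word `(k₁, …, k_ℓ)` is primitive. -/
def primitiveCyclicCompositions (K ℓ : ℕ) : Set (Cycle ℕ) :=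
  {c | ∃ γ : Composition K, γ.length = ℓ ∧ IsPrimitiveWord γ.blocks ∧ (γ.blocks : Cycle ℕ) = c}

/-- `M(K, ℓ)`, the number of primitive cyclic compositions of weight `K` and length `ℓ`. -/
noncomputable def primitiveCount (K ℓ : ℕ) : ℕ :=
  (primitiveCyclicCompositions K ℓ).ncard

theorem primitiveCyclicCompositions_finite (K ℓ : ℕ) :
    (primitiveCyclicCompositions K ℓ).Finite :=
  (Set.finite_range fun γ : Composition K => (γ.blocks : Cycle ℕ)).subset
    fun _ ⟨γ, _, _, h⟩ => ⟨γ, h⟩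

theorem primitiveCount_eq_zero_of_lt {K ℓ : ℕ} (h : K < ℓ) : primitiveCount K ℓ = 0 := by
  have : primitiveCyclicCompositions K ℓ = ∅ := by
    ext c
    simp only [primitiveCyclicCompositions, Set.mem_ofPred_eq, Set.mem_empty_iff_false, iff_false]
    rintro ⟨γ, hγ, -, -⟩
    have := γ.length_le
    omega
  simp [primitiveCount, this]

/-- The gain rate at depth `K`,
`R(K) = 2^(-K) * ∑_{ℓ > K / log₂ 3} M(K, ℓ) * (log₂ 3 - K / ℓ)`.
The sum may be cut off at `ℓ = K`, since `M(K, ℓ) = 0` for `ℓ > K`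
(`primitiveCount_eq_zero_of_lt`). -/
noncomputable def gainRate (K : ℕ) : ℝ :=
  ((2 : ℝ) ^ K)⁻¹ *
    ∑ ℓ ∈ (Finset.Icc 1 K).filter (fun ℓ : ℕ => (K : ℝ) / Real.logb 2 3 < (ℓ : ℝ)),
      (primitiveCount K ℓ : ℝ) * (Real.logb 2 3 - (K : ℝ) / (ℓ : ℝ))

/-- `R = ∑_{K ≥ 3} R(K)`, indexed by `K = n + 3`. -/
noncomputable def totalGainRate : ℝ := ∑' n : ℕ, gainRate (n + 3)

/-- `ε = 2 - log₂ 3`. -/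
noncomputable def contractionBudget : ℝ := 2 - Real.logb 2 3

/-! A primitive class of length `ℓ` consists of `ℓ` distinct words, so `ℓ * M(K, ℓ)` is at most the
number of compositions, `(K - 1).choose (ℓ - 1)`, less any proper powers among them
(`mul_primitiveCount_le`, `length_mul_primitiveCount_add_le`). Removing powers is essential: the
all-ones words alone would add about 0.04 to `R`.

Gain needs `ℓ / K > 1 / log₂ 3 ≈ 0.631`, above the typical density `1/2`, so an exponential moment
bound makes `R(K)` decay like `((√3 + 1) / (2√2)) ^ K / K ^ 2` (`gainRate_le_geometric`). This gives
convergence and leaves at most 0.0002 for `K ≥ 100`. The depths `3 ≤ K < 100` are bounded by 0.0883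
in exact integer arithmetic, rounding upwards (`sum_scaledGainRate_le`). -/

/-! ### Counting compositions -/

/-- The words of length `ℓ` with positive letters and letter sum `K`. -/
def compositionWords (K ℓ : ℕ) : Set (List ℕ) :=
  {w | w.length = ℓ ∧ w.sum = K ∧ ∀ x ∈ w, 0 < x}

theorem compositionWords_one_right (n : ℕ) : compositionWords (n + 1) 1 = {[n + 1]} := by
  ext w
  simp only [compositionWords, Set.mem_ofPred_eq, Set.mem_singleton_iff]
  constructor
  · rintro ⟨h1, h2, -⟩
    obtain ⟨a, rfl⟩ := List.length_eq_one_iff.1 h1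
    simpa using h2
  · rintro rfl
    simp

theorem compositionWords_one_left (k : ℕ) : compositionWords 1 (k + 2) = ∅ := by
  ext w
  simp only [compositionWords, Set.mem_ofPred_eq, Set.mem_empty_iff_false, iff_false]
  rintro ⟨h1, h2, h3⟩
  match w, h1 with
  | a :: b :: t, _ =>
    have := h3 a (by simp)
    have := h3 b (by simp)
    simp only [List.sum_cons] at h2
    omega

/-- Pascal's rule: a leading 1 is deleted, a larger leading letter is lowered by 1. -/
theorem compositionWords_succ (n k : ℕ) :
    compositionWords (n + 2) (k + 2) =
      (List.cons 1) '' compositionWords (n + 1) (k + 1) ∪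
        (List.modifyHead (· + 1)) '' compositionWords (n + 1) (k + 2) := by
  ext w
  simp only [compositionWords, Set.mem_ofPred_eq, Set.mem_union, Set.mem_image]
  constructor
  · rintro ⟨h1, h2, h3⟩
    match w, h1 with
    | a :: t, h1 =>
      simp only [List.length_cons, List.sum_cons, List.mem_cons, forall_eq_or_imp] at h1 h2 h3
      rcases Nat.lt_or_ge 1 a with ha | ha
      · refine Or.inr ⟨(a - 1) :: t, ⟨by simpa using h1, ?_, ?_⟩, ?_⟩
        · simp only [List.sum_cons]; omega
        · simp only [List.mem_cons, forall_eq_or_imp]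
          exact ⟨by omega, h3.2⟩
        · simp only [List.modifyHead_cons, List.cons.injEq, and_true]; omega
      · obtain rfl : a = 1 := by omega
        exact Or.inl ⟨t, ⟨by omega, by omega, h3.2⟩, rfl⟩
  · rintro (⟨t, ⟨h1, h2, h3⟩, rfl⟩ | ⟨t, ⟨h1, h2, h3⟩, rfl⟩)
    · simp only [List.length_cons, List.sum_cons, List.mem_cons, forall_eq_or_imp]
      exact ⟨by omega, by omega, one_pos, h3⟩
    · match t, h1 with
      | a :: t, h1 =>
        simp only [List.length_cons, List.sum_cons, List.mem_cons, forall_eq_or_imp,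
          List.modifyHead_cons] at *
        exact ⟨by omega, by omega, by omega, h3.2⟩

theorem compositionWords_finite_and_ncard (n k : ℕ) :
    (compositionWords (n + 1) (k + 1)).Finite ∧
      (compositionWords (n + 1) (k + 1)).ncard = n.choose k := by
  induction n generalizing k with
  | zero =>
    cases k with
    | zero => simp [compositionWords_one_right]
    | succ k => simp [compositionWords_one_left]
  | succ n ih =>
    cases k with
    | zero => simp [compositionWords_one_right]
    | succ k =>
      have hd : Disjoint ((List.cons 1) '' compositionWords (n + 1) (k + 1))
          ((List.modifyHead (· + 1)) '' compositionWords (n + 1) (k + 2)) := by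
        rw [Set.disjoint_left]
        rintro _ ⟨t, -, rfl⟩ ⟨s, ⟨-, -, hs⟩, h⟩
        cases s with
        | nil => simp at h
        | cons a s =>
          have := hs a (by simp)
          simp only [List.modifyHead_cons, List.cons.injEq] at h
          omega
      have h1 : Function.Injective (List.cons 1) := List.cons_injective
      have h2 : Function.Injective (List.modifyHead (· + 1) : List ℕ → List ℕ) := by
        intro a b h
        cases a <;> cases b <;> simp_all
      have f1 := (ih k).1.image (List.cons 1)
      have f2 := (ih (k + 1)).1.image (List.modifyHead (· + 1))
      rw [compositionWords_succ]
      refine ⟨f1.union f2, ?_⟩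
      rw [Set.ncard_union_eq hd f1 f2, Set.ncard_image_of_injective _ h1,
        Set.ncard_image_of_injective _ h2, (ih k).2, (ih (k + 1)).2, Nat.choose_succ_succ]

theorem compositionWords_finite {K ℓ : ℕ} (hK : 0 < K) (hℓ : 0 < ℓ) :
    (compositionWords K ℓ).Finite := by
  obtain ⟨n, rfl⟩ := Nat.exists_eq_add_one.2 hK
  obtain ⟨k, rfl⟩ := Nat.exists_eq_add_one.2 hℓ
  exact (compositionWords_finite_and_ncard n k).1

theorem ncard_compositionWords {K ℓ : ℕ} (hK : 0 < K) (hℓ : 0 < ℓ) :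
    (compositionWords K ℓ).ncard = (K - 1).choose (ℓ - 1) := by
  obtain ⟨n, rfl⟩ := Nat.exists_eq_add_one.2 hK
  obtain ⟨k, rfl⟩ := Nat.exists_eq_add_one.2 hℓ
  exact (compositionWords_finite_and_ncard n k).2

/-! ### Rotation classes and proper powers -/

theorem IsPrimitiveWord.rotate {w : List ℕ} (h : IsPrimitiveWord w) (n : ℕ) :
    IsPrimitiveWord (w.rotate n) := by
  intro i hi hil e
  rw [List.length_rotate] at hil
  rw [List.rotate_rotate, Nat.add_comm, ← List.rotate_rotate, List.rotate_eq_rotate] at e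
  exact h i hi hil e

theorem IsPrimitiveWord.rotate_inj {w : List ℕ} (h : IsPrimitiveWord w) {i j : ℕ}
    (hi : i < w.length) (hj : j < w.length) (e : w.rotate i = w.rotate j) : i = j := by
  wlog hij : i ≤ j generalizing i j
  · exact (this hj hi e.symm (by omega)).symm
  by_contra hne
  obtain ⟨m, rfl⟩ := Nat.exists_eq_add_of_le hij
  rw [Nat.add_comm, ← List.rotate_rotate, List.rotate_eq_rotate] at e
  exact h m (by omega) (by omega) e.symm

/-- Every primitive cyclic composition of length `ℓ` accounts for `ℓ` primitive words. -/
theorem mul_primitiveCount_le {K ℓ : ℕ} (hK : 0 < K) (hℓ : 0 < ℓ) :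
    ℓ * primitiveCount K ℓ ≤ (compositionWords K ℓ ∩ {w | IsPrimitiveWord w}).ncard := by
  have hfin : (compositionWords K ℓ ∩ {w | IsPrimitiveWord w}).Finite :=
    (compositionWords_finite hK hℓ).inter_of_left _
  choose! γ hγ using fun (c : Cycle ℕ) (hc : c ∈ primitiveCyclicCompositions K ℓ) => hc
  -- With one representative per class, the pair (shift, class) can be recovered from the rotated
  -- word.
  have hinj : Set.InjOn (fun p : ℕ × Cycle ℕ => (γ p.2).blocks.rotate p.1)
      (Set.Iio ℓ ×ˢ primitiveCyclicCompositions K ℓ) := by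
    rintro ⟨i, c⟩ ⟨hi, hc⟩ ⟨j, c'⟩ ⟨hj, hc'⟩ e
    simp only [Set.mem_Iio] at hi hj hc hc' e
    have hcc : c = c' := by
      rw [← (hγ c hc).2.2, ← (hγ c' hc').2.2, Cycle.coe_eq_coe]
      exact (List.IsRotated.forall _ i).symm.trans (e ▸ List.IsRotated.forall _ j)
    subst hcc
    have hlen : (γ c).blocks.length = ℓ := (hγ c hc).1
    rw [(hγ c hc).2.1.rotate_inj (by omega) (by omega) e]
  have hmaps : Set.MapsTo (fun p : ℕ × Cycle ℕ => (γ p.2).blocks.rotate p.1)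
      (Set.Iio ℓ ×ˢ primitiveCyclicCompositions K ℓ)
      (compositionWords K ℓ ∩ {w | IsPrimitiveWord w}) := by
    rintro ⟨i, c⟩ ⟨-, hc⟩
    have hlen : (γ c).blocks.length = ℓ := (hγ c hc).1
    refine ⟨⟨by simpa using hlen, ?_, fun x hx => ?_⟩, (hγ c hc).2.1.rotate i⟩
    · rw [((γ c).blocks.rotate_perm i).sum_eq, (γ c).blocks_sum]
    · exact (γ c).blocks_pos (List.mem_rotate.1 hx)
  have := Set.ncard_le_ncard_of_injOn _ hmaps hinj hfin
  rwa [Set.ncard_prod, Set.ncard_Iio_nat] at this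

theorem length_mul_primitiveCount_le_choose {K ℓ : ℕ} (hK : 0 < K) (hℓ : 0 < ℓ) :
    ℓ * primitiveCount K ℓ ≤ (K - 1).choose (ℓ - 1) := by
  rw [← ncard_compositionWords hK hℓ]
  exact (mul_primitiveCount_le hK hℓ).trans
    (Set.ncard_le_ncard Set.inter_subset_left (compositionWords_finite hK hℓ))

/-- The proper `d`-th powers are compositions that are not primitive. -/
theorem length_mul_primitiveCount_add_le {d k l : ℕ} (hd : 2 ≤ d) (hk : 0 < k) (hl : 0 < l) :
    d * l * primitiveCount (d * k) (d * l) + (k - 1).choose (l - 1) ≤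
      (d * k - 1).choose (d * l - 1) := by
  have hK : 0 < d * k := by positivity
  have hL : 0 < d * l := by positivity
  set f : List ℕ → List ℕ := fun v => (List.replicate d v).flatten with hf
  obtain ⟨e, rfl⟩ : ∃ e, d = e + 2 := ⟨d - 2, by omega⟩
  have hfv (v : List ℕ) : f v = v ++ (List.replicate (e + 1) v).flatten := by
    simp [hf, List.replicate_succ]
  have hfv' (v : List ℕ) : f v = (List.replicate (e + 1) v).flatten ++ v := by
    simp [hf, List.replicate_succ' (n := e + 1)]
  have hinj : Set.InjOn f (compositionWords k l) := by
    intro v hv w hw h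
    rw [hfv, hfv] at h
    exact (List.append_inj h (hv.1.trans hw.1.symm)).1
  have hsub : f '' compositionWords k l ⊆
      compositionWords ((e + 2) * k) ((e + 2) * l) \ {w | IsPrimitiveWord w} := by
    rintro _ ⟨v, ⟨h1, h2, h3⟩, rfl⟩
    have hlen : (f v).length = (e + 2) * l := by simp [hf, h1]
    refine ⟨⟨hlen, ?_, fun x hx => ?_⟩, fun hp => ?_⟩
    · simp [hf, List.sum_flatten, h2]
    · obtain ⟨t, ht, hx⟩ := List.mem_flatten.1 hx
      rw [List.eq_of_mem_replicate ht] at hx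
      exact h3 x hx
    -- Rotating by one period `l`, which is less than the full length as the exponent is at least 2,
    -- fixes the power.
    · refine hp l hl (by rw [hlen]; nlinarith) ?_
      conv_lhs => rw [hfv, ← h1, List.rotate_append_length_eq]
      exact (hfv' v).symm
  have hfin := compositionWords_finite hK hL
  have h1 := Set.ncard_le_ncard hsub (hfin.subset Set.sdiff_subset)
  rw [hinj.ncard_image, ncard_compositionWords hk hl] at h1
  have h2 := mul_primitiveCount_le hK hL
  have h3 := Set.ncard_inter_add_ncard_sdiff_eq_ncard
    (compositionWords ((e + 2) * k) ((e + 2) * l)) {w | IsPrimitiveWord w} hfin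
  rw [ncard_compositionWords hK hL] at h3
  omega
-- Rational bounds for `log₂ 3`
set_option exponentiation.threshold 500 in
theorem logb_two_three_lt : Real.logb 2 3 < 485 / 306 := by
  rw [Real.logb_lt_iff_lt_rpow (by norm_num) (by norm_num)]
  -- `485 / 306` is a continued fraction convergent; the claim becomes `3 ^ 306 < 2 ^ 485`.
  refine lt_of_pow_lt_pow_left₀ 306 (by positivity) ?_
  rw [← Real.rpow_natCast, ← Real.rpow_natCast, ← Real.rpow_mul (by norm_num),
    show (485 / 306 : ℝ) * (306 : ℕ) = (485 : ℕ) by norm_num, Real.rpow_natCast,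
    Real.rpow_natCast]
  norm_num

theorem lt_logb_two_three : (84 / 53 : ℝ) < Real.logb 2 3 := by
  rw [Real.lt_logb_iff_rpow_lt (by norm_num) (by norm_num)]
  refine lt_of_pow_lt_pow_left₀ 53 (by positivity) ?_
  rw [← Real.rpow_natCast, ← Real.rpow_natCast, ← Real.rpow_mul (by norm_num),
    show (84 / 53 : ℝ) * (53 : ℕ) = (84 : ℕ) by norm_num, Real.rpow_natCast,
    Real.rpow_natCast]
  norm_num

theorem logb_two_three_pos : 0 < Real.logb 2 3 := Real.logb_pos (by norm_num) (by norm_num)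

/-- Membership in the summation range of `gainRate`. -/
theorem mem_gainRange {K ℓ : ℕ}
    (h : ℓ ∈ (Finset.Icc 1 K).filter (fun ℓ : ℕ => (K : ℝ) / Real.logb 2 3 < (ℓ : ℝ))) :
    0 < ℓ ∧ ℓ ≤ K ∧ (K : ℝ) < Real.logb 2 3 * ℓ := by
  rw [Finset.mem_filter, Finset.mem_Icc, div_lt_iff₀' logb_two_three_pos] at h
  exact ⟨h.1.1, h.1.2, h.2⟩

/-! ### Exponential tail bound and convergence -/

theorem gainTerm_nonneg {K ℓ : ℕ} (hℓ : 0 < ℓ) (h : (K : ℝ) < Real.logb 2 3 * ℓ) :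
    0 ≤ (primitiveCount K ℓ : ℝ) * (Real.logb 2 3 - (K : ℝ) / (ℓ : ℝ)) := by
  have : (0 : ℝ) < ℓ := by exact_mod_cast hℓ
  refine mul_nonneg (Nat.cast_nonneg _) (sub_nonneg.2 ?_)
  rw [div_le_iff₀ this]
  exact h.le

theorem gainRate_nonneg (K : ℕ) : 0 ≤ gainRate K := by
  refine mul_nonneg (by positivity) (Finset.sum_nonneg fun ℓ hℓ => ?_)
  obtain ⟨h1, -, h3⟩ := mem_gainRange hℓ
  exact gainTerm_nonneg h1 h3

/-- Absorption, `ℓ * K.choose ℓ = K * (K - 1).choose (ℓ - 1)`, trades the factor `ℓ` for `K`, so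
that the sum over `ℓ` becomes binomial. -/
theorem mul_primitiveCount_le_choose {K ℓ : ℕ} (hK : 0 < K) (hℓ : 0 < ℓ) :
    K * primitiveCount K ℓ ≤ K.choose ℓ := by
  have h := length_mul_primitiveCount_le_choose hK hℓ
  obtain ⟨n, rfl⟩ := Nat.exists_eq_add_one.2 hK
  obtain ⟨k, rfl⟩ := Nat.exists_eq_add_one.2 hℓ
  have h2 := Nat.add_one_mul_choose_eq n k
  simp only [Nat.add_sub_cancel] at h
  refine Nat.le_of_mul_le_mul_right ?_ hℓ
  rw [← h2]
  calc (n + 1) * primitiveCount (n + 1) (k + 1) * (k + 1)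
      = (n + 1) * ((k + 1) * primitiveCount (n + 1) (k + 1)) := by ring
    _ ≤ _ := Nat.mul_le_mul_left _ h

/-- With `x` the left side, this is `1 + y ≤ exp y` at `y = x * log 2 / 2 - 1`, since `2 ^ (x / 2) =
√3 ^ ℓ / √2 ^ K`. The weight `√3` is nearly optimal: its mean density `√3 / (1 + √3) ≈ 0.634` is
close to the threshold. -/
theorem logb_mul_sub_le (K ℓ : ℕ) :
    Real.logb 2 3 * ℓ - K ≤ 2 / (Real.log 2 * Real.exp 1) *
      (Real.exp (Real.log 3 / 2) ^ ℓ * (Real.exp (Real.log 2 / 2) ^ K)⁻¹) := by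
  have hl : 0 < Real.log 2 := Real.log_pos (by norm_num)
  have h := Real.add_one_le_exp (Real.log 2 / 2 * (Real.logb 2 3 * ℓ - K) - 1)
  have e : Real.exp (Real.log 2 / 2 * (Real.logb 2 3 * ℓ - K) - 1) =
      Real.exp (Real.log 3 / 2) ^ ℓ * (Real.exp (Real.log 2 / 2) ^ K)⁻¹ * (Real.exp 1)⁻¹ := by
    rw [← Real.exp_nat_mul, ← Real.exp_nat_mul, ← Real.exp_neg, ← Real.exp_neg, ← Real.exp_add,
      ← Real.exp_add, Real.logb]
    congr 1
    field_simp
    ring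
  rw [e, sub_add_cancel] at h
  calc Real.logb 2 3 * ℓ - K
      = 2 / Real.log 2 * (Real.log 2 / 2 * (Real.logb 2 3 * ℓ - K)) := by field_simp
    _ ≤ 2 / Real.log 2 * _ := mul_le_mul_of_nonneg_left h (by positivity)
    _ = _ := by field_simp

theorem chernoff_base_le :
    (Real.exp (Real.log 3 / 2) + 1) / (2 * Real.exp (Real.log 2 / 2)) ≤ 0.96593 := by
  have h3 : Real.exp (Real.log 3 / 2) ^ 2 = 3 := by
    rw [← Real.exp_nat_mul, Nat.cast_ofNat, mul_div_cancel₀ _ two_ne_zero,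
      Real.exp_log (by norm_num)]
  have h2 : Real.exp (Real.log 2 / 2) ^ 2 = 2 := by
    rw [← Real.exp_nat_mul, Nat.cast_ofNat, mul_div_cancel₀ _ two_ne_zero,
      Real.exp_log (by norm_num)]
  have p2 := Real.exp_pos (Real.log 2 / 2)
  have u3 : Real.exp (Real.log 3 / 2) ≤ 1.7320509 :=
    le_of_pow_le_pow_left₀ two_ne_zero (by norm_num) (by rw [h3]; norm_num)
  have u2 : 1.4142135 ≤ Real.exp (Real.log 2 / 2) :=
    le_of_pow_le_pow_left₀ two_ne_zero p2.le (by rw [h2]; norm_num)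
  rw [div_le_iff₀ (by positivity)]
  linarith

theorem tail_constant_le : Real.logb 2 3 * (2 / (Real.log 2 * Real.exp 1)) ≤ 1.69 := by
  have h1 := Real.log_two_gt_d9
  have h2 := Real.exp_one_gt_d9
  have h3 := logb_two_three_lt
  have h4 : (0.6931471803 : ℝ) * 2.7182818283 ≤ Real.log 2 * Real.exp 1 := by gcongr
  calc Real.logb 2 3 * (2 / (Real.log 2 * Real.exp 1))
      ≤ 485 / 306 * (2 / (0.6931471803 * 2.7182818283)) := by gcongr
    _ ≤ 1.69 := by norm_num

/-- Chernoff bound for the gain rate. -/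
theorem gainRate_le_geometric {K : ℕ} (hK : 0 < K) :
    gainRate K ≤ 1.69 / (K : ℝ) ^ 2 * 0.96593 ^ K := by
  have hK' : (0 : ℝ) < K := by exact_mod_cast hK
  set a := Real.exp (Real.log 3 / 2) with ha
  set b := Real.exp (Real.log 2 / 2) with hb
  set c := 2 / (Real.log 2 * Real.exp 1) with hc
  have hl : 0 < Real.log 2 := Real.log_pos (by norm_num)
  have ha0 : 0 < a := Real.exp_pos _
  have hb0 : 0 < b := Real.exp_pos _
  have hc0 : 0 < c := by positivity
  have hL := logb_two_three_pos
  have hterm : ∀ ℓ ∈ (Finset.Icc 1 K).filter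
      (fun ℓ : ℕ => (K : ℝ) / Real.logb 2 3 < (ℓ : ℝ)),
      (primitiveCount K ℓ : ℝ) * (Real.logb 2 3 - (K : ℝ) / (ℓ : ℝ)) ≤
        Real.logb 2 3 * c / (K : ℝ) ^ 2 * (b ^ K)⁻¹ * (a ^ ℓ * K.choose ℓ) := by
    intro ℓ hℓ
    obtain ⟨h1, -, h3⟩ := mem_gainRange hℓ
    have h1' : (0 : ℝ) < ℓ := by exact_mod_cast h1
    have hM : (primitiveCount K ℓ : ℝ) ≤ K.choose ℓ / K := by
      rw [le_div_iff₀' hK']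
      exact_mod_cast mul_primitiveCount_le_choose hK h1
    have hx : Real.logb 2 3 - (K : ℝ) / ℓ ≤
        Real.logb 2 3 / K * (c * (a ^ ℓ * (b ^ K)⁻¹)) := by
      calc Real.logb 2 3 - (K : ℝ) / ℓ = 1 / ℓ * (Real.logb 2 3 * ℓ - K) := by field_simp
        _ ≤ Real.logb 2 3 / K * (Real.logb 2 3 * ℓ - K) := by
            refine mul_le_mul_of_nonneg_right ?_ (by linarith)
            -- In the gain range `1 / ℓ < log₂ 3 / K`; this supplies the second factor `1 / K`.
            rw [div_le_div_iff₀ h1' hK']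
            linarith
        _ ≤ _ := mul_le_mul_of_nonneg_left (logb_mul_sub_le K ℓ) (by positivity)
    calc _ ≤ (K.choose ℓ / K : ℝ) * (Real.logb 2 3 / K * (c * (a ^ ℓ * (b ^ K)⁻¹))) := by
          gcongr
          rw [sub_nonneg, div_le_iff₀ h1']
          exact h3.le
      _ = _ := by ring
  calc gainRate K
      ≤ ((2 : ℝ) ^ K)⁻¹ * ∑ ℓ ∈ Finset.range (K + 1),
          Real.logb 2 3 * c / (K : ℝ) ^ 2 * (b ^ K)⁻¹ * (a ^ ℓ * K.choose ℓ) := by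
        refine mul_le_mul_of_nonneg_left ((Finset.sum_le_sum hterm).trans ?_) (by positivity)
        refine Finset.sum_le_sum_of_subset_of_nonneg (fun ℓ hℓ => ?_)
          fun ℓ _ _ => by positivity
        exact Finset.mem_range_succ_iff.2 (mem_gainRange hℓ).2.1
    _ = Real.logb 2 3 * c / (K : ℝ) ^ 2 * ((a + 1) / (2 * b)) ^ K := by
        rw [← Finset.mul_sum, div_pow, add_pow, mul_pow]
        simp only [one_pow, mul_one]
        field_simp
    _ ≤ 1.69 / (K : ℝ) ^ 2 * 0.96593 ^ K := by
        gcongr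
        · exact tail_constant_le
        · exact chernoff_base_le

theorem summable_gainRate : Summable fun n : ℕ => gainRate (n + 3) := by
  refine Summable.of_nonneg_of_le (fun n => gainRate_nonneg _) (fun n => ?_)
    ((summable_geometric_of_lt_one (r := (0.96593 : ℝ)) (by norm_num)
      (by norm_num)).mul_left 1.69)
  refine (gainRate_le_geometric (by omega)).trans ?_
  have h : (1 : ℝ) ≤ ((n + 3 : ℕ) : ℝ) ^ 2 := one_le_pow₀ (by exact_mod_cast (by omega))
  refine mul_le_mul (div_le_self (by norm_num) h) ?_ (by positivity) (by norm_num)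
  exact pow_le_pow_of_le_one (by norm_num) (by norm_num) (by omega)

theorem tsum_gainRate_tail_le (N : ℕ) (hN : 0 < N) :
    ∑' n : ℕ, gainRate (n + N) ≤ 1.69 / (N : ℝ) ^ 2 * 0.96593 ^ N * (1 - 0.96593)⁻¹ := by
  have hN' : (0 : ℝ) < N := by exact_mod_cast hN
  have hg := (hasSum_geometric_of_lt_one (r := (0.96593 : ℝ)) (by norm_num)
    (by norm_num)).mul_left (1.69 / (N : ℝ) ^ 2 * 0.96593 ^ N)
  have hle (n : ℕ) : gainRate (n + N) ≤ 1.69 / (N : ℝ) ^ 2 * 0.96593 ^ N * 0.96593 ^ n := by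
    refine (gainRate_le_geometric (by omega)).trans ?_
    rw [mul_assoc, ← pow_add, Nat.add_comm N n]
    gcongr
    omega
  rw [← hg.tsum_eq]
  exact Summable.tsum_le_tsum hle (Summable.of_nonneg_of_le (fun _ => gainRate_nonneg _) hle
    hg.summable) hg.summable

theorem gainRate_three_pos : 0 < gainRate 3 := by
  have hL := lt_logb_two_three
  have hL' := logb_two_three_lt
  refine mul_pos (by positivity) ?_
  have hmem : 2 ∈ (Finset.Icc 1 3).filter
      (fun ℓ : ℕ => ((3 : ℕ) : ℝ) / Real.logb 2 3 < (ℓ : ℝ)) := by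
    rw [Finset.mem_filter, div_lt_iff₀' logb_two_three_pos]
    refine ⟨by simp, ?_⟩
    push_cast
    linarith
  refine Finset.sum_pos' (fun ℓ hℓ => ?_) ⟨2, hmem, ?_⟩
  · obtain ⟨h1, -, h3⟩ := mem_gainRange hℓ
    exact gainTerm_nonneg h1 h3
  · have hM : 0 < primitiveCount 3 2 := by
      refine (Set.ncard_pos (primitiveCyclicCompositions_finite 3 2)).2
        ⟨([1, 2] : List ℕ), ⟨[1, 2], by simp, by simp⟩, rfl, ?_, rfl⟩
      intro i h1 h2
      obtain rfl : i = 1 := by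
        simp only [List.length_cons, List.length_nil] at h2
        omega
      decide
    refine mul_pos (by exact_mod_cast hM) ?_
    push_cast
    linarith
-- Integer arithmetic for the head
/-- An upper bound for the number of primitive words of weight `K` and length `ℓ`: all words,
less the `d`-th powers for one prime `d ≤ 7` dividing `K` and `ℓ`. -/
def primitiveWordBound (K ℓ : ℕ) : ℕ :=
  -- The quotient form of the binomial coefficient avoids Pascal's branching recursion in kernel
  -- evaluation.
  let c (n k : ℕ) : ℕ := n.descFactorial k / k.factorial
  let b (d : ℕ) : ℕ := c (K - 1) (ℓ - 1) - c (K / d - 1) (ℓ / d - 1)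
  if 2 ∣ K ∧ 2 ∣ ℓ then b 2 else
  if 3 ∣ K ∧ 3 ∣ ℓ then b 3 else
  if 5 ∣ K ∧ 5 ∣ ℓ then b 5 else
  if 7 ∣ K ∧ 7 ∣ ℓ then b 7 else c (K - 1) (ℓ - 1)

theorem length_mul_primitiveCount_le_bound {K ℓ : ℕ} (hK : 0 < K) (hℓ : 0 < ℓ) :
    ℓ * primitiveCount K ℓ ≤ primitiveWordBound K ℓ := by
  have key : ∀ d, 2 ≤ d → d ∣ K ∧ d ∣ ℓ → ℓ * primitiveCount K ℓ ≤
      (K - 1).choose (ℓ - 1) - (K / d - 1).choose (ℓ / d - 1) := by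
    rintro d hd ⟨⟨k, rfl⟩, ⟨l, rfl⟩⟩
    have hd0 : 0 < d := by omega
    rw [Nat.mul_div_cancel_left _ hd0, Nat.mul_div_cancel_left _ hd0]
    exact Nat.le_sub_of_add_le (length_mul_primitiveCount_add_le hd
      (Nat.pos_of_mul_pos_left hK) (Nat.pos_of_mul_pos_left hℓ))
  simp only [primitiveWordBound, ← Nat.choose_eq_descFactorial_div_factorial]
  split_ifs with h2 h3 h5 h7
  · exact key 2 (by norm_num) h2
  · exact key 3 (by norm_num) h3
  · exact key 5 (by norm_num) h5
  · exact key 7 (by norm_num) h7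
  · exact length_mul_primitiveCount_le_choose hK hℓ

/-- `10 ^ 12` times the contribution of `(K, ℓ)` to the gain rate, bounded above. -/
def scaledGain (K ℓ : ℕ) : ℕ :=
  if 306 * K < 485 * ℓ then
    primitiveWordBound K ℓ * (485 * ℓ - 306 * K) * 10 ^ 12 / (306 * ℓ ^ 2 * 2 ^ K) + 1
  else 0

/-- `10 ^ 12` times the gain rate at depth `K`, bounded above. -/
def scaledGainRate (K : ℕ) : ℕ := ∑ ℓ ∈ Finset.range (K + 1), scaledGain K ℓ

theorem gainRate_le_scaledGainRate {K : ℕ} (hK : 0 < K) :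
    gainRate K ≤ scaledGainRate K / 10 ^ 12 := by
  rw [gainRate, scaledGainRate, Nat.cast_sum, Finset.sum_div, Finset.mul_sum]
  have hsub : (Finset.Icc 1 K).filter (fun ℓ : ℕ => (K : ℝ) / Real.logb 2 3 < (ℓ : ℝ)) ⊆
      Finset.range (K + 1) := fun ℓ hℓ => Finset.mem_range_succ_iff.2 (mem_gainRange hℓ).2.1
  refine (Finset.sum_le_sum fun ℓ hℓ => ?_).trans
    (Finset.sum_le_sum_of_subset_of_nonneg hsub fun ℓ _ _ => by positivity)
  obtain ⟨h1, -, h3⟩ := mem_gainRange hℓ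
  have h1' : (0 : ℝ) < ℓ := by exact_mod_cast h1
  have hL := logb_two_three_lt
  have hlt : (306 : ℝ) * K < 485 * ℓ := by nlinarith
  have hlt' : 306 * K < 485 * ℓ := by exact_mod_cast hlt
  rw [scaledGain, if_pos hlt']
  have hM : (primitiveCount K ℓ : ℝ) ≤ primitiveWordBound K ℓ / ℓ := by
    rw [le_div_iff₀' h1']
    exact_mod_cast length_mul_primitiveCount_le_bound hK h1
  -- The `+ 1` in `scaledGain` makes up for the floor in natural division.
  have hdiv := Nat.lt_div_mul_add (a := primitiveWordBound K ℓ * (485 * ℓ - 306 * K) * 10 ^ 12)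
    (b := 306 * ℓ ^ 2 * 2 ^ K) (by positivity)
  rw [← Nat.add_one_mul] at hdiv
  generalize primitiveWordBound K ℓ * (485 * ℓ - 306 * K) * 10 ^ 12 /
    (306 * ℓ ^ 2 * 2 ^ K) + 1 = q at hdiv ⊢
  have hq : (primitiveWordBound K ℓ : ℝ) * (485 * ℓ - 306 * K) * 10 ^ 12 <
      q * (306 * ℓ ^ 2 * 2 ^ K) := by
    have := (Nat.cast_lt (α := ℝ)).2 hdiv
    push_cast [Nat.cast_sub hlt'.le] at this
    linarith
  calc ((2 : ℝ) ^ K)⁻¹ * ((primitiveCount K ℓ : ℝ) * (Real.logb 2 3 - (K : ℝ) / ℓ))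
      ≤ ((2 : ℝ) ^ K)⁻¹ * (primitiveWordBound K ℓ / ℓ * (485 / 306 - (K : ℝ) / ℓ)) := by
        gcongr
        rw [sub_nonneg, div_le_iff₀ h1']
        exact h3.le
    _ = (primitiveWordBound K ℓ : ℝ) * (485 * ℓ - 306 * K) / (306 * ℓ ^ 2 * 2 ^ K) := by
        field_simp
    _ ≤ q / 10 ^ 12 := by
        rw [div_le_div_iff₀ (by positivity) (by positivity)]
        exact hq.le

theorem sum_scaledGainRate_le :
    ∑ n ∈ Finset.range 97, scaledGainRate (n + 3) ≤ 88300000000 := by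
  decide +kernel

/-! ### Head plus tail, and the ratio -/

theorem totalGainRate_le : totalGainRate ≤ 0.0885 := by
  have hsplit := summable_gainRate.sum_add_tsum_nat_add 97
  have htail := tsum_gainRate_tail_le 100 (by norm_num)
  have hhead : ∑ n ∈ Finset.range 97, gainRate (n + 3) ≤ 0.0883 := by
    have h : ((∑ n ∈ Finset.range 97, scaledGainRate (n + 3) : ℕ) : ℝ) ≤ (88300000000 : ℕ) :=
      Nat.cast_le.2 sum_scaledGainRate_le
    calc ∑ n ∈ Finset.range 97, gainRate (n + 3)
        ≤ ∑ n ∈ Finset.range 97, (scaledGainRate (n + 3) : ℝ) / 10 ^ 12 :=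
          Finset.sum_le_sum fun n _ => gainRate_le_scaledGainRate (by omega)
      _ = ((∑ n ∈ Finset.range 97, scaledGainRate (n + 3) : ℕ) : ℝ) / 10 ^ 12 := by
          rw [← Finset.sum_div, Nat.cast_sum]
      _ ≤ (88300000000 : ℕ) / 10 ^ 12 := by gcongr
      _ = 0.0883 := by norm_num
  have hbound : (1.69 : ℝ) / ((100 : ℕ) : ℝ) ^ 2 * 0.96593 ^ 100 * (1 - 0.96593)⁻¹ ≤ 0.0002 := by
    norm_num
  rw [totalGainRate, ← hsplit]
  have : ∑' n : ℕ, gainRate (n + 97 + 3) = ∑' n : ℕ, gainRate (n + 100) := rfl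
  linarith

theorem totalGainRate_pos : 0 < totalGainRate :=
  summable_gainRate.tsum_pos (fun _ => gainRate_nonneg _) 0 gainRate_three_pos

theorem mainTheorem8 :
    Summable (fun n : ℕ => |gainRate (n + 3)|) ∧
      totalGainRate ≤ 0.0893 ∧
      0.0893 < contractionBudget ∧
      |contractionBudget - 0.415| < 0.0005 ∧
      4.65 ≤ contractionBudget / totalGainRate := by
  have h1 := logb_two_three_lt
  have h2 := lt_logb_two_three
  have h3 := totalGainRate_le
  refine ⟨summable_gainRate.abs, by linarith, ?_, ?_, ?_⟩
  · rw [contractionBudget]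
    linarith
  · rw [contractionBudget, abs_lt]
    constructor <;> linarith
  -- The sharper bound 0.0885 is needed here: `4.65 * 0.0893` already exceeds `ε`.
  · rw [le_div_iff₀ totalGainRate_pos, contractionBudget]
    linarith
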